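/- Let $G$ be a finite group and let $L$ be a $G$-lattice, that is, a finitely generated free abelian group with a $\mathbb{Z}$-linear action of $G$. Say that $L$ is essentially complex if there is a $G$-equivariant $\mathbb{R}$-linear endomorphism $J$ of $\mathbb{R}\otimes_{\mathbb{Z}} L$ with $J^2=-\mathrm{id}$. For a simple $\mathbb{Q}G$-module $V$ with character $\chi_V$, let $\chi$ be any complex irreducible character of $G$ with $(\chi_V,\chi)\neq 0$. The module $V$ is of real type if the Frobenius–Schur indicator $\nu_2(\chi)=\frac{1}{|G|}\sum_{g\in G}\chi(g^2)$ equals $1$, and $m(V)$ denotes the Schur index $m_{\mathbb{Q}}(\chi)$ of $\chi$ over $\mathbb{Q}$, that is, the multiplicity of $\chi$ in the complexification of an irreducible $\mathbb{Q}$-representation of $G$ having $\chi$ as a constituent; neither notion depends on the choice of $\chi$. Then $L$ is essentially complex if and only if every simple component $V$ of $\mathbb{Q}\otimes_{\mathbb{Z}} L$ that is of real type and has odd $m(V)$ occurs in $\mathbb{Q}\otimes_{\mathbb{Z}} L$ with even multiplicity. -/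

import Mathlib

open scoped TensorProduct MonoidAlgebra

noncomputable section

namespace GLattice

variable {G : Type*} [Group G]

/-- Extension of scalars of a representation: `V^F = F ⊗ V` with `g • (a ⊗ v) = a ⊗ (g • v)`. -/
def extend {K : Type*} [CommRing K] (F : Type*) [CommRing F] [Algebra K F]
    {V : Type*} [AddCommGroup V] [Module K V] (ρ : Representation K G V) :
    Representation F G (F ⊗[K] V) where
  toFun g := (ρ g).baseChange F
  map_one' := by rw [map_one]; exact LinearMap.baseChange_one K V
  map_mul' g h := by rw [map_mul]; exact LinearMap.baseChange_mul _ _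

/-- A complex structure on a `K G`-module `V`: a `G`-equivariant `ℝ`-linear endomorphism `J` of
`V^ℝ` with `J² = -id`. -/
structure ComplexStructure {K : Type*} [CommRing K] [Algebra K ℝ]
    {V : Type*} [AddCommGroup V] [Module K V] (ρ : Representation K G V) where
  J : Module.End ℝ (ℝ ⊗[K] V)
  comm : ∀ g : G, J ∘ₗ extend ℝ ρ g = extend ℝ ρ g ∘ₗ J
  sq : J ∘ₗ J = -LinearMap.id

/-- A module is essentially complex if it admits a complex structure. -/
def IsEssentiallyComplex {K : Type*} [CommRing K] [Algebra K ℝ]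
    {V : Type*} [AddCommGroup V] [Module K V] (ρ : Representation K G V) : Prop :=
  Nonempty (ComplexStructure ρ)

/-- The set of complex irreducible characters of `G`. -/
def Irr (G : Type*) [Group G] : Set (G → ℂ) :=
  {χ | ∃ (n : ℕ) (σ : Representation ℂ G (Fin n → ℂ)), σ.IsIrreducible ∧ χ = σ.character}

/-- The usual inner product of complex valued functions on a finite group. -/
def charInner [Fintype G] (φ ψ : G → ℂ) : ℂ :=
  (Fintype.card G : ℂ)⁻¹ * ∑ g : G, φ g * (starRingEnd ℂ) (ψ g)

/-- The Frobenius-Schur indicator `ν₂(χ)`. -/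
def frobeniusSchur [Fintype G] (χ : G → ℂ) : ℂ :=
  (Fintype.card G : ℂ)⁻¹ * ∑ g : G, χ (g ^ 2)

/-- The character of a representation over a field `F` equipped with an embedding in `ℂ`, as a
complex valued function. -/
def complexCharacter {F : Type*} [Field F] [Algebra F ℂ]
    {V : Type*} [AddCommGroup V] [Module F V] (σ : Representation F G V) : G → ℂ :=
  fun g => algebraMap F ℂ (σ.character g)

/-- `χ` is an irreducible complex constituent of (the complexification of) `σ`. -/
def IsConstituent [Fintype G] {F : Type*} [Field F] [Algebra F ℂ]
    {V : Type*} [AddCommGroup V] [Module F V] (χ : G → ℂ) (σ : Representation F G V) : Prop :=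
  χ ∈ Irr G ∧ charInner (complexCharacter σ) χ ≠ 0

/-- The Schur index `m_F(χ)` of an irreducible complex character `χ` over `F`: the multiplicity
of `χ` in the complexification of an irreducible `F`-representation `σ` having `χ` as a
constituent. Such a `σ` exists and is unique up to isomorphism, so the set below is a
singleton. -/
def schurIndex [Fintype G] (F : Type*) [Field F] [Algebra F ℂ] (χ : G → ℂ) : ℕ :=
  sInf {m : ℕ | ∃ (n : ℕ) (σ : Representation F G (Fin n → F)), σ.IsIrreducible ∧
    IsConstituent χ σ ∧ charInner (complexCharacter σ) χ = (m : ℂ)}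

/-- A simple module is of real type if `ν₂(χ) = 1` for an irreducible complex constituent `χ` of
its character; `ν₂(χ)` does not depend on the choice of `χ`. -/
def IsRealType [Fintype G] {F : Type*} [Field F] [Algebra F ℂ]
    {V : Type*} [AddCommGroup V] [Module F V] (σ : Representation F G V) : Prop :=
  ∃ χ : G → ℂ, IsConstituent χ σ ∧ frobeniusSchur χ = 1

/-- The number `m(V)` of a simple `ℚ G`-module `V`: the Schur index `m_ℚ(χ)` of an irreducible
complex constituent `χ` of its character. It does not depend on the choice of `χ`, so the set
below is a singleton. -/
def rationalSchurIndex [Fintype G] {V : Type*} [AddCommGroup V] [Module ℚ V]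
    (σ : Representation ℚ G V) : ℕ :=
  sInf {m : ℕ | ∃ χ : G → ℂ, IsConstituent χ σ ∧ m = schurIndex ℚ χ}

/-- The multiplicity of a simple module `S` in a semisimple module `M` of finite length: the number
`k` such that the `S`-homogeneous component of `M` is isomorphic to `S^k`. -/
def simpleMultiplicity (R M S : Type*) [Ring R] [AddCommGroup M] [Module R M]
    [AddCommGroup S] [Module R S] : ℕ :=
  sInf {k : ℕ | Nonempty (isotypicComponent R M S ≃ₗ[R] (Fin k → S))}

end GLattice

end

/-! Both sides are equivalent to a single condition on the complex character of `L`: every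
irreducible `χ` with `ν₂(χ) = 1` occurs in it with even multiplicity.

Over `ℝ`: a complex structure splits the complexification into its `i` and `-i` eigenspaces, whose
characters are complex conjugate. A `χ` with nonzero indicator is real valued, so it occurs equally
often in both (`exists_even_charInner_of_hasComplexStructure`). Conversely, split off simple
summands `S`. If `S` has no complex structure of its own, its endomorphism ring is `ℝ`, so its
complexification is irreducible with indicator `1`. Evenness then provides a second copy of `S`, and
`S ⊕ S` carries `(x, y) ↦ (-y, x)` (`hasComplexStructure_of_forall_even`).

Over `ℚ`: if `χ` occurs in the simple component `V`, it occurs in no other isotype, so its total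
multiplicity is the multiplicity of `V` times that of `χ` in `V`. The second factor is `m(V)`, and
the product is even exactly when `m(V)` is even or `V` occurs evenly
(`forall_even_simpleMultiplicity_iff`). Independence of `m(V)` from `χ` is Galois conjugacy of the
constituents of `V`, obtained in `charInner_eq_of_isConstituent` from central characters and
automorphisms of `ℂ`. -/

noncomputable section

namespace GLattice

open Representation

/-! ### Intertwining maps, splittings and the group algebra -/

section General

variable {k G : Type*} [Field k] [Group G]
variable {V W U : Type*} [AddCommGroup V] [Module k V] [AddCommGroup W] [Module k W]
  [AddCommGroup U] [Module k U]

theorem sum_character_mul_character_inv [CharZero k] [Fintype G] [FiniteDimensional k V]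
    [FiniteDimensional k W] (ρ : Representation k G V) (σ : Representation k G W) :
    ∑ g : G, σ.character g * ρ.character g⁻¹ =
      (Fintype.card G : k) * (Module.finrank k (IntertwiningMap ρ σ) : k) := by
  have h0 : (Nat.card G : k) ≠ 0 := by simp
  let : Invertible (Nat.card G : k) := invertibleOfNonzero h0
  rw [← card_inv_mul_sum_char_mul_char_eq_finrank, ← mul_assoc, ← Nat.card_eq_fintype_card,
    mul_inv_cancel₀ h0, one_mul]

/-- The character formula for the dimension is symmetric under `g ↦ g⁻¹`. -/
theorem finrank_intertwiningMap_comm [CharZero k] [Finite G] [FiniteDimensional k V]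
    [FiniteDimensional k W] (ρ : Representation k G V) (σ : Representation k G W) :
    Module.finrank k (IntertwiningMap ρ σ) = Module.finrank k (IntertwiningMap σ ρ) := by
  have := Fintype.ofFinite G
  have h1 := sum_character_mul_character_inv ρ σ
  have h2 := sum_character_mul_character_inv σ ρ
  rw [← Equiv.sum_comp (Equiv.inv G)] at h2
  simp only [Equiv.inv_apply, inv_inv] at h2
  simp_rw [mul_comm (ρ.character _)] at h2
  have h3 := h1.symm.trans h2
  have h0 : (Fintype.card G : k) ≠ 0 := by simp
  exact_mod_cast mul_left_cancel₀ h0 h3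

theorem character_prod [FiniteDimensional k V] [FiniteDimensional k W]
    (ρ : Representation k G V) (σ : Representation k G W) (g : G) :
    (ρ.prod σ).character g = ρ.character g + σ.character g :=
  LinearMap.trace_prodMap' (ρ g) (σ g)

/-- An injective equivariant map from a representation of a finite group splits. -/
theorem exists_equiv_prod_of_injective [CharZero k] [Finite G]
    {ρ : Representation k G V} {σ : Representation k G W} (f : IntertwiningMap ρ σ)
    (hf : Function.Injective f) :
    ∃ (T : Subrepresentation σ) (e : Representation.Equiv (ρ.prod T.toRepresentation) σ),
      ∀ x, e x = f x.1 + x.2 := by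
  have : NeZero (Nat.card G : k) := ⟨Nat.cast_ne_zero.2 Nat.card_pos.ne'⟩
  obtain ⟨T, hT⟩ := exists_isCompl f.range
  have hT' : IsCompl (LinearMap.range f.toLinearMap) T.toSubmodule := by
    constructor
    · rw [Submodule.disjoint_def]
      intro x hx hx'
      have : f.range ⊓ T ≤ ⊥ := hT.1.le_bot
      exact this (show x ∈ f.range ⊓ T from ⟨hx, hx'⟩)
    · rw [codisjoint_iff_le_sup]
      intro x _
      have : ⊤ ≤ f.range ⊔ T := hT.2.top_le
      exact this (show x ∈ (⊤ : Subrepresentation σ) from Submodule.mem_top)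
  refine ⟨T, IntertwiningMap.ofBijective
    ⟨f.toLinearMap.coprod T.toSubmodule.subtype, ?_⟩ ⟨?_, ?_⟩, fun _ => rfl⟩
  · intro g
    ext x
    · simpa using f.isIntertwining ρ σ g x
    · simp [Subrepresentation.toRepresentation]
  · rw [IntertwiningMap.coe_mk, ← LinearMap.ker_eq_bot, LinearMap.ker_coprod_of_disjoint_range]
    · rw [LinearMap.ker_eq_bot.2 hf, Submodule.ker_subtype, Submodule.prod_bot]
    · rw [Submodule.range_subtype]; exact hT'.1
  · rw [IntertwiningMap.coe_mk, ← LinearMap.range_eq_top, LinearMap.range_coprod,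
      Submodule.range_subtype]
    exact hT'.sup_eq_top

/-- The `k[G]`-linear equivalence underlying an equivalence of representations. -/
def asModuleCongr {ρ : Representation k G V} {σ : Representation k G W}
    (e : Representation.Equiv ρ σ) : ρ.asModule ≃ₗ[k[G]] σ.asModule :=
  LinearEquiv.ofBijective (IntertwiningMap.equivLinearMapAsModule ρ σ e.toIntertwiningMap)
    e.toLinearEquiv.bijective

theorem isIrreducible_of_equiv {ρ : Representation k G V} {σ : Representation k G W}
    (e : Representation.Equiv ρ σ) (h : σ.IsIrreducible) : ρ.IsIrreducible := by
  rw [irreducible_iff_isSimpleModule_asModule] at h ⊢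
  exact (LinearEquiv.isSimpleModule_iff (R := k[G]) (M := ρ.asModule) (N := σ.asModule)
    (asModuleCongr e)).2 h

/-- A subrepresentation, viewed as a submodule over the group algebra. -/
def asModuleEquivAsSubmodule {ρ : Representation k G V} (T : Subrepresentation ρ) :
    T.toRepresentation.asModule ≃ₗ[k[G]] T.asSubmodule :=
  LinearEquiv.ofBijective
    (LinearMap.codRestrict T.asSubmodule
      (IntertwiningMap.equivLinearMapAsModule T.toRepresentation ρ
        ⟨T.toSubmodule.subtype, fun _ => rfl⟩) (fun x => x.2))
    ⟨fun _ _ h => Subtype.ext (congrArg (fun z => (z : V)) (congrArg Subtype.val h)),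
      fun y => ⟨⟨y.1, y.2⟩, rfl⟩⟩

theorem exists_isIrreducible_subrepresentation [CharZero k] [Finite G] [Nontrivial V]
    (ρ : Representation k G V) :
    ∃ T : Subrepresentation ρ, T.toRepresentation.IsIrreducible := by
  have : NeZero (Nat.card G : k) := ⟨Nat.cast_ne_zero.2 Nat.card_pos.ne'⟩
  have : Nontrivial ρ.asModule := inferInstanceAs (Nontrivial V)
  obtain ⟨m, hm⟩ := IsSemisimpleModule.exists_simple_submodule k[G] ρ.asModule
  refine ⟨Subrepresentation.ofSubmodule' m, ?_⟩
  rw [irreducible_iff_isSimpleModule_asModule]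
  exact (LinearEquiv.isSimpleModule_iff (R := k[G])
    (M := (Subrepresentation.ofSubmodule' m).toRepresentation.asModule) (N := m)
    (asModuleEquivAsSubmodule (Subrepresentation.ofSubmodule' m))).2 hm

/-- The inclusion of a subrepresentation. -/
def inclusion {ρ : Representation k G V} (T : Subrepresentation ρ) :
    IntertwiningMap T.toRepresentation ρ :=
  ⟨T.toSubmodule.subtype, fun _ => rfl⟩

theorem inclusion_injective {ρ : Representation k G V} (T : Subrepresentation ρ) :
    Function.Injective (inclusion T) := Subtype.val_injective

end General

/-! ### Invariant Hermitian forms -/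

section Form

open Matrix

open scoped ComplexOrder

/-- A matrix representation of a finite group leaves a nondegenerate Hermitian form invariant. -/
theorem exists_invariant_form {𝕜 G n : Type*} [RCLike 𝕜] [Group G] [Finite G] [Fintype n]
    [DecidableEq n] (A : G →* Matrix n n 𝕜) :
    ∃ B : Matrix n n 𝕜, IsUnit B ∧ Bᴴ = B ∧ ∀ g, (A g)ᴴ * B = B * A g⁻¹ := by
  classical
  have := Fintype.ofFinite G
  have key : ∀ g, (A g)ᴴ * (∑ h, (A h)ᴴ * A h) * A g = ∑ h, (A h)ᴴ * A h := by
    intro g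
    conv_rhs => rw [← Equiv.sum_comp (Equiv.mulRight g)]
    rw [Finset.mul_sum, Finset.sum_mul]
    refine Finset.sum_congr rfl fun h _ => ?_
    simp only [Equiv.coe_mulRight, map_mul, Matrix.conjTranspose_mul, mul_assoc]
  have hpos : (∑ h, (A h)ᴴ * A h).PosDef := by
    have h1 : ∀ s : Finset G, (∑ h ∈ s, (A h)ᴴ * A h).PosSemidef := by
      intro s
      exact Matrix.posSemidef_sum s fun h _ => Matrix.posSemidef_conjTranspose_mul_self (A h)
    -- Each term is only known to be semidefinite; the term at `1` is the identity matrix and makes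
    -- the sum definite.
    rw [← Finset.add_sum_erase _ _ (Finset.mem_univ (1 : G))]
    refine Matrix.PosDef.add_posSemidef ?_ (h1 _)
    rw [map_one, Matrix.conjTranspose_one, one_mul]
    exact Matrix.PosDef.one
  refine ⟨∑ h, (A h)ᴴ * A h, hpos.isUnit, hpos.1, fun g => ?_⟩
  rw [← key g, mul_assoc _ (A g), ← map_mul, mul_inv_cancel, map_one, mul_one, key g]

/-- An invariant Hermitian form conjugates `A g⁻¹` into `(A g)ᴴ`, so the two have the same trace. -/
theorem conj_character {G V : Type*} [Group G] [Finite G] [AddCommGroup V] [Module ℂ V]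
    [FiniteDimensional ℂ V] (τ : Representation ℂ G V) (g : G) :
    (starRingEnd ℂ) (τ.character g) = τ.character g⁻¹ := by
  classical
  let b := Module.finBasis ℂ V
  let A : G →* Matrix _ _ ℂ := (LinearMap.toMatrixAlgEquiv b).toAlgHom.toMonoidHom.comp τ
  obtain ⟨B, hB, -, h⟩ := exists_invariant_form A
  have tr : ∀ g, τ.character g = (A g).trace := fun g => LinearMap.trace_eq_matrix_trace ℂ b (τ g)
  obtain ⟨u, rfl⟩ := hB
  have : (A g)ᴴ = u * A g⁻¹ * (u⁻¹ : (Matrix _ _ ℂ)ˣ) := by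
    rw [← h, mul_assoc, Units.mul_inv, mul_one]
  rw [tr, tr, starRingEnd_apply, ← Matrix.trace_conjTranspose, this, Matrix.trace_mul_cycle,
    Units.inv_mul, one_mul]

end Form

/-! ### Irreducible complex characters -/

section Irr

variable {G : Type*} [Group G]

theorem exists_intertwiningMap_ne_zero {k V W : Type*} [Field k] [AddCommGroup V] [Module k V]
    [AddCommGroup W] [Module k W] {ρ : Representation k G V} {σ : Representation k G W}
    (h : Module.finrank k (IntertwiningMap ρ σ) ≠ 0) : ∃ f : IntertwiningMap ρ σ, f ≠ 0 := by
  by_contra! hn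
  have : Subsingleton (IntertwiningMap ρ σ) := ⟨fun a b => (hn a).trans (hn b).symm⟩
  exact h (Module.finrank_zero_of_subsingleton)

/-- An injective equivariant map is an equivalence onto its range. -/
def equivRange {k V W : Type*} [Field k] [AddCommGroup V] [Module k V]
    [AddCommGroup W] [Module k W] {ρ : Representation k G V} {σ : Representation k G W}
    (f : IntertwiningMap ρ σ) (hf : Function.Injective f) :
    Representation.Equiv ρ f.range.toRepresentation :=
  .mk (LinearEquiv.ofInjective f.toLinearMap hf) fun g => by
    refine LinearMap.ext fun x => Subtype.ext ?_
    exact f.isIntertwining _ _ g x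

theorem nontrivial_of_isIrreducible {k V : Type*} [Field k] [AddCommGroup V] [Module k V]
    {ρ : Representation k G V} (h : ρ.IsIrreducible) : Nontrivial V := by
  by_contra hs
  rw [not_nontrivial_iff_subsingleton] at hs
  refine absurd h.toNontrivial (not_nontrivial_iff_subsingleton.2 ⟨fun A B => ?_⟩)
  exact SetLike.ext fun x => by
    rw [Subsingleton.elim x 0]
    exact ⟨fun _ => B.toSubmodule.zero_mem, fun _ => A.toSubmodule.zero_mem⟩

variable {V W : Type*} [AddCommGroup V] [AddCommGroup W]

theorem character_mem_Irr [Module ℂ V] [FiniteDimensional ℂ V] (τ : Representation ℂ G V)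
    (hτ : τ.IsIrreducible) : τ.character ∈ Irr G := by
  let e := (Module.finBasis ℂ V).equivFun
  let σ : Representation ℂ G (Fin (Module.finrank ℂ V) → ℂ) :=
    e.conjAlgEquiv ℂ |>.toAlgHom.toMonoidHom.comp τ
  let E : Representation.Equiv τ σ := .mk e fun g => by
    ext x
    simp [σ, LinearEquiv.conjAlgEquiv]
  exact ⟨_, σ, isIrreducible_of_equiv E.symm hτ, char_iso E⟩

end Irr

theorem charInner_add {G : Type*} [Fintype G] (φ ψ χ : G → ℂ) :
    charInner (φ + ψ) χ = charInner φ χ + charInner ψ χ := by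
  simp [charInner, add_mul, Finset.sum_add_distrib, mul_add]

/-! ### Extension of scalars and character pairings -/

section Extend

variable {G : Type*} [Group G]

theorem character_extend {K : Type*} [CommRing K] {F : Type*} [Field F] [Algebra K F]
    {V : Type*} [AddCommGroup V] [Module K V] [Module.Free K V] [Module.Finite K V]
    (ρ : Representation K G V) (g : G) :
    (extend F ρ).character g = algebraMap K F (LinearMap.trace K V (ρ g)) :=
  LinearMap.trace_baseChange (ρ g) F

variable {F : Type*} [Field F] [Algebra F ℂ]
variable {V W : Type*} [AddCommGroup V] [Module F V] [FiniteDimensional F V]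
  [AddCommGroup W] [Module F W] [FiniteDimensional F W]

theorem complexCharacter_eq_character_extend (σ : Representation F G V) :
    complexCharacter σ = (extend ℂ σ).character := by
  ext g
  rw [character_extend]
  rfl

theorem complexCharacter_equiv {F V W : Type*} [Field F] [Algebra F ℂ] [AddCommGroup V]
    [Module F V] [AddCommGroup W] [Module F W] {σ : Representation F G V} {τ : Representation F G W}
    (e : Representation.Equiv σ τ) : complexCharacter σ = complexCharacter τ := by
  unfold complexCharacter
  rw [char_iso e]

theorem complexCharacter_prod (σ : Representation F G V) (τ : Representation F G W) :
    complexCharacter (σ.prod τ) = complexCharacter σ + complexCharacter τ := by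
  ext g
  simp [complexCharacter, character_prod]

variable [Fintype G]

theorem charInner_character {V W : Type*} [AddCommGroup V] [Module ℂ V] [FiniteDimensional ℂ V]
    [AddCommGroup W] [Module ℂ W] [FiniteDimensional ℂ W]
    (σ : Representation ℂ G V) (τ : Representation ℂ G W) :
    charInner σ.character τ.character = Module.finrank ℂ (IntertwiningMap τ σ) := by
  simp_rw [charInner, conj_character]
  rw [sum_character_mul_character_inv, ← mul_assoc, inv_mul_cancel₀ (by simp), one_mul]

theorem charInner_self_of_mem_Irr {χ : G → ℂ} (h : χ ∈ Irr G) : charInner χ χ = 1 := by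
  obtain ⟨n, τ, hτ, rfl⟩ := h
  rw [charInner_character, IsIrreducible.finrank_intertwiningMap_self]
  simp

theorem exists_natCast_eq_charInner (σ : Representation F G V) {χ : G → ℂ} (h : χ ∈ Irr G) :
    ∃ m : ℕ, charInner (complexCharacter σ) χ = m := by
  obtain ⟨n, τ, hτ, rfl⟩ := h
  rw [complexCharacter_eq_character_extend, charInner_character]
  exact ⟨_, rfl⟩

/-- The pairing of the complex characters of two representations over a subfield of `ℂ`. -/
theorem charInner_complexCharacter (σ : Representation F G V) (τ : Representation F G W) :
    charInner (complexCharacter σ) (complexCharacter τ) =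
      Module.finrank F (IntertwiningMap τ σ) := by
  have : CharZero F := (algebraMap F ℂ).charZero
  have h := congrArg (algebraMap F ℂ) (sum_character_mul_character_inv τ σ)
  simp only [map_sum, map_mul, map_natCast] at h
  have h2 : ∀ g, (starRingEnd ℂ) (complexCharacter τ g) = complexCharacter τ g⁻¹ := by
    intro g
    rw [complexCharacter_eq_character_extend, conj_character]
  simp_rw [charInner, h2]
  rw [show ∑ g, complexCharacter σ g * complexCharacter τ g⁻¹ = _ from h, ← mul_assoc,
    inv_mul_cancel₀ (by simp), one_mul]

/-- A representation containing a given irreducible complex constituent has an irreducible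
subrepresentation containing it. -/
theorem exists_subrepresentation_isConstituent (σ : Representation F G V) {χ : G → ℂ}
    (h : IsConstituent χ σ) :
    ∃ T : Subrepresentation σ, T.toRepresentation.IsIrreducible ∧
      IsConstituent χ T.toRepresentation := by
  have : CharZero F := (algebraMap F ℂ).charZero
  induction hn : Module.finrank F V using Nat.strong_induction_on generalizing V with
  | _ n ih =>
  rcases subsingleton_or_nontrivial V with hV | hV
  · refine absurd ?_ h.2
    have : complexCharacter σ = 0 := by
      ext g
      simp [complexCharacter, Representation.character, Subsingleton.elim (σ g) 0]
    simp [this, charInner]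
  obtain ⟨S, hS⟩ := exists_isIrreducible_subrepresentation σ
  by_cases hc : IsConstituent χ S.toRepresentation
  · exact ⟨S, hS, hc⟩
  -- If `χ` is not in the simple piece `S`, it is in a complement of smaller dimension, where
  -- induction applies.
  obtain ⟨T, e, -⟩ := exists_equiv_prod_of_injective (inclusion S) (inclusion_injective S)
  have hT : IsConstituent χ T.toRepresentation := by
    refine ⟨h.1, fun h0 => h.2 ?_⟩
    have h1 : charInner (complexCharacter S.toRepresentation) χ = 0 := by
      by_contra h1
      exact hc ⟨h.1, h1⟩
    rw [← complexCharacter_equiv e, complexCharacter_prod, charInner_add, h0, h1, add_zero]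
  have hS0 := nontrivial_of_isIrreducible hS
  have hlt : Module.finrank F T.toSubmodule < n := by
    have h1 := e.toLinearEquiv.finrank_eq
    rw [Module.finrank_prod] at h1
    have := Module.finrank_pos (R := F) (M := S.toSubmodule)
    omega
  obtain ⟨R, hR, hRc⟩ := ih _ hlt T.toRepresentation hT rfl
  let f : IntertwiningMap R.toRepresentation σ := (inclusion T).comp (inclusion R)
  have hf : Function.Injective f := (inclusion_injective T).comp (inclusion_injective R)
  refine ⟨f.range, isIrreducible_of_equiv (equivRange f hf).symm hR, h.1, ?_⟩
  rw [← complexCharacter_equiv (equivRange f hf)]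
  exact hRc.2

end Extend

/-! ### Irreducible representations sharing a complex constituent -/

section Rational

variable {G : Type*} [Group G] [Fintype G]
variable {F : Type*} [Field F] [Algebra F ℂ]
variable {V W : Type*} [AddCommGroup V] [Module F V] [FiniteDimensional F V]
  [AddCommGroup W] [Module F W] [FiniteDimensional F W]

/-- Irreducible representations with a common complex constituent are equivalent. -/
theorem nonempty_equiv_of_isConstituent {σ : Representation F G V} {τ : Representation F G W}
    (hσ : σ.IsIrreducible) (hτ : τ.IsIrreducible) {χ : G → ℂ} (h : IsConstituent χ σ)
    (h' : IsConstituent χ τ) : Nonempty (Representation.Equiv σ τ) := by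
  obtain ⟨⟨n, π, hπ, rfl⟩, h1⟩ := h
  have h2 := h'.2
  rw [complexCharacter_eq_character_extend, charInner_character] at h1 h2
  rw [Ne, Nat.cast_eq_zero] at h1 h2
  rw [finrank_intertwiningMap_comm] at h1
  obtain ⟨f, hf⟩ := exists_intertwiningMap_ne_zero h1
  obtain ⟨g, hg⟩ := exists_intertwiningMap_ne_zero h2
  have hfs := (IsIrreducible.surjective_or_eq_zero f).resolve_right hf
  have hgi := (IsIrreducible.injective_or_eq_zero g).resolve_right hg
  have hgf : g.comp f ≠ 0 := by
    intro h0
    apply hf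
    refine DFunLike.ext _ _ fun x => hgi ?_
    simpa using DFunLike.congr_fun h0 x
  -- The dimensions of the intertwining spaces over `F` and over `ℂ` are the same character pairing,
  -- so the nonzero complex map `g.comp f` forces a nonzero map over `F`.
  have h3 : Module.finrank F (IntertwiningMap σ τ) ≠ 0 := by
    have h4 := charInner_complexCharacter τ σ
    rw [complexCharacter_eq_character_extend, complexCharacter_eq_character_extend,
      charInner_character] at h4
    intro h0
    rw [h0, Nat.cast_inj, Module.finrank_zero_iff] at h4
    exact hgf (Subsingleton.elim _ _)
  obtain ⟨k, hk⟩ := exists_intertwiningMap_ne_zero h3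
  exact ⟨k.ofBijective ((IsIrreducible.bijective_or_eq_zero k).resolve_right hk)⟩

end Rational

/-! ### Automorphisms of the complex numbers -/

section Automorphism

open Cardinal

/-- Over a countable base, a transcendence basis of an uncountable algebraically closed field has
the cardinality of the field. A bijection of bases identifies the polynomial subrings, and `K`, `L`
are algebraic closures of these. -/
theorem exists_ringEquiv_comp_eq_of_injective {R : Type*} {K L : Type} [CommRing R] [Field K]
    [Field L] [IsAlgClosed K] [IsAlgClosed L] (hR : #R ≤ ℵ₀) (hK : ℵ₀ < #K) (hKL : #K = #L)
    (f : R →+* K) (g : R →+* L) (hf : Function.Injective f) (hg : Function.Injective g) :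
    ∃ σ : K ≃+* L, ∀ r, σ (f r) = g r := by
  have : IsDomain R := hf.isDomain f
  let : Algebra R K := f.toAlgebra
  let : Algebra R L := g.toAlgebra
  have : FaithfulSMul R K := (faithfulSMul_iff_algebraMap_injective R K).2 hf
  have : FaithfulSMul R L := (faithfulSMul_iff_algebraMap_injective R L).2 hg
  obtain ⟨s, hs⟩ := exists_isTranscendenceBasis R K
  obtain ⟨t, ht⟩ := exists_isTranscendenceBasis R L
  have hst : #s = #t := by
    have h1 := IsAlgClosed.cardinal_eq_cardinal_transcendence_basis_of_aleph0_lt _ hs hR hK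
    have h2 := IsAlgClosed.cardinal_eq_cardinal_transcendence_basis_of_aleph0_lt _ ht hR
      (hKL ▸ hK)
    simp only [Cardinal.lift_id] at h1 h2
    rw [← h1, ← h2, hKL]
  obtain ⟨e⟩ := Cardinal.eq.1 hst
  have := IsAlgClosed.isAlgClosure_of_transcendence_basis _ hs
  have := IsAlgClosed.isAlgClosure_of_transcendence_basis _ ht
  let E := (hs.1.aevalEquiv.symm.trans (MvPolynomial.renameEquiv R e)).trans ht.1.aevalEquiv
  refine ⟨IsAlgClosure.equivOfEquiv K L E.toRingEquiv, fun r => ?_⟩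
  have h1 : f r = algebraMap (Algebra.adjoin R (Set.range ((↑) : s → K))) K
    (algebraMap R _ r) := rfl
  rw [h1, IsAlgClosure.equivOfEquiv_algebraMap]
  exact congrArg _ (E.commutes r)

/-- Two ring homomorphisms from a countable ring to `ℂ` with the same kernel are related by an
automorphism of `ℂ`. -/
theorem exists_ringEquiv_comp_eq {R : Type*} [CommRing R] (hR : #R ≤ ℵ₀) (f g : R →+* ℂ)
    (h : RingHom.ker f = RingHom.ker g) : ∃ σ : ℂ ≃+* ℂ, ∀ r, σ (f r) = g r := by
  obtain ⟨σ, hσ⟩ := exists_ringEquiv_comp_eq_of_injective (R := R ⧸ RingHom.ker f)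
    (Cardinal.mk_quotient_le.trans hR)
    (by rw [Cardinal.mk_complex]; exact Cardinal.aleph0_lt_continuum) rfl (RingHom.kerLift f)
    (Ideal.Quotient.lift (RingHom.ker f) g fun a ha => by rwa [h] at ha)
    (RingHom.kerLift_injective f)
    (RingHom.lift_injective_of_ker_le_ideal _ (fun a ha => by rwa [h] at ha) h.ge)
  exact ⟨σ, fun r => hσ (Ideal.Quotient.mk _ r)⟩

end Automorphism

/-! ### Central characters and Galois conjugacy of constituents -/

section CentralCharacter

variable {G : Type*} [Group G]

theorem asAlgebraHom_comm {k V W : Type*} [Field k] [AddCommGroup V] [Module k V]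
    [AddCommGroup W] [Module k W] {ρ : Representation k G V} {σ : Representation k G W}
    (f : IntertwiningMap ρ σ) (a : k[G]) (v : V) :
    f (ρ.asAlgebraHom a v) = σ.asAlgebraHom a (f v) := by
  induction a using MonoidAlgebra.induction_linear with
  | zero => simp
  | add x y hx hy => simp [hx, hy]
  | single g a => simp [f.isIntertwining]

/-- The action of the rational group algebra on a complex representation. -/
def ratAction {V : Type*} [AddCommGroup V] [Module ℂ V] (τ : Representation ℂ G V) :
    ℚ[G] →+* Module.End ℂ V :=
  (τ.asAlgebraHom : ℂ[G] →+* Module.End ℂ V).comp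
    (MonoidAlgebra.mapRingHom G (algebraMap ℚ ℂ))

theorem ratAction_single {V : Type*} [AddCommGroup V] [Module ℂ V] (τ : Representation ℂ G V)
    (g : G) (a : ℚ) : ratAction τ (MonoidAlgebra.single g a) = (a : ℂ) • τ g := by
  simp [ratAction]

theorem ratAction_comm {V W : Type*} [AddCommGroup V] [Module ℂ V]
    [AddCommGroup W] [Module ℂ W] {ρ : Representation ℂ G V} {σ : Representation ℂ G W}
    (f : IntertwiningMap ρ σ) (a : ℚ[G]) (v : V) :
    f (ratAction ρ a v) = ratAction σ a (f v) :=
  asAlgebraHom_comm f _ v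

theorem ratAction_extend {V : Type*} [AddCommGroup V] [Module ℚ V] (σ : Representation ℚ G V)
    (a : ℚ[G]) : ratAction (extend ℂ σ) a = (σ.asAlgebraHom a).baseChange ℂ := by
  induction a using MonoidAlgebra.induction_linear with
  | zero => simp
  | add x y hx hy => simp [hx, hy]
  | single g a =>
    rw [ratAction_single, asAlgebraHom_single]
    ext v
    simp [extend, TensorProduct.smul_tmul']

/-- The center of the rational group algebra acts on an irreducible complex representation
through its central character. -/
theorem exists_centralCharacter {V : Type*} [AddCommGroup V] [Module ℂ V] [FiniteDimensional ℂ V]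
    (τ : Representation ℂ G V) (hτ : τ.IsIrreducible) :
    ∃ ω : Subalgebra.center ℚ ℚ[G] →+* ℂ, ∀ (c : Subalgebra.center ℚ ℚ[G]) (v : V),
      ratAction τ c v = ω c • v := by
  have hV := nontrivial_of_isIrreducible hτ
  have key : ∀ c : Subalgebra.center ℚ ℚ[G], ∃ z : ℂ, ∀ v, ratAction τ c v = z • v := by
    intro c
    let f : IntertwiningMap τ τ := ⟨ratAction τ c, fun g => by
      have h1 : τ g = ratAction τ (MonoidAlgebra.single g 1) := by simp [ratAction_single]
      have h2 := (Subalgebra.mem_center_iff.1 c.2) (MonoidAlgebra.single g 1)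
      rw [h1, ← Module.End.mul_eq_comp, ← Module.End.mul_eq_comp, ← map_mul, ← map_mul, h2]⟩
    obtain ⟨z, hz⟩ := (IsIrreducible.algebraMap_intertwiningMap_bijective_of_isAlgClosed
      (ρ := τ)).2 f
    exact ⟨z, fun v => (DFunLike.congr_fun hz v).symm⟩
  choose ω hω using key
  obtain ⟨v, hv⟩ := exists_ne (0 : V)
  have inj : ∀ {a b : ℂ}, a • v = b • v → a = b := fun h => smul_left_injective ℂ hv h
  refine ⟨⟨⟨⟨ω, ?_⟩, ?_⟩, ?_, ?_⟩, hω⟩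
  · apply inj
    rw [← hω]
    simp
  · intro a b
    apply inj
    simp only [← hω, mul_smul]
    simp
  · apply inj
    rw [← hω]
    simp
  · intro a b
    apply inj
    simp only [← hω, add_smul]
    simp

variable [Fintype G]

/-- The sum of the conjugates of `g`, as an element of the center of the rational group algebra. -/
def classSum (g : G) : Subalgebra.center ℚ ℚ[G] :=
  ⟨∑ x : G, MonoidAlgebra.single (x * g * x⁻¹) 1, by
    rw [Subalgebra.mem_center_iff]
    intro b
    induction b using MonoidAlgebra.induction_linear with
    | zero => simp
    | add x y hx hy => rw [add_mul, mul_add, hx, hy]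
    | single h a =>
      conv_lhs => rw [← Equiv.sum_comp (Equiv.mulLeft h⁻¹)]
      rw [Finset.mul_sum, Finset.sum_mul]
      refine Finset.sum_congr rfl fun x _ => ?_
      simp [MonoidAlgebra.single_mul_single, mul_assoc]⟩

theorem trace_ratAction_classSum {V : Type*} [AddCommGroup V] [Module ℂ V] [FiniteDimensional ℂ V]
    (τ : Representation ℂ G V) (g : G) :
    LinearMap.trace ℂ V (ratAction τ (classSum g)) = Fintype.card G * τ.character g := by
  simp only [classSum, map_sum, ratAction_single, Rat.cast_one, one_smul]
  have : ∀ x : G, LinearMap.trace ℂ V (τ (x * g * x⁻¹)) = τ.character g := char_conj τ g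
  simp only [this, Finset.sum_const, Finset.card_univ, nsmul_eq_mul]

/-- The kernel of the central character of a complex constituent of an irreducible rational
representation is the annihilator of the latter. -/
theorem centralCharacter_eq_zero_iff {V N : Type*} [AddCommGroup V] [Module ℚ V]
    [FiniteDimensional ℚ V] [AddCommGroup N] [Module ℂ N] [FiniteDimensional ℂ N]
    {σ : Representation ℚ G V} (hσ : σ.IsIrreducible) {τ : Representation ℂ G N}
    (hτ : τ.IsIrreducible) (h : charInner (complexCharacter σ) τ.character ≠ 0)
    {ω : Subalgebra.center ℚ ℚ[G] →+* ℂ}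
    (hω : ∀ (c : Subalgebra.center ℚ ℚ[G]) (v : N), ratAction τ c v = ω c • v)
    (c : Subalgebra.center ℚ ℚ[G]) : ω c = 0 ↔ σ.asAlgebraHom c = 0 := by
  have hN := nontrivial_of_isIrreducible hτ
  rw [complexCharacter_eq_character_extend, charInner_character, Ne, Nat.cast_eq_zero] at h
  obtain ⟨g, hg⟩ := exists_intertwiningMap_ne_zero h
  have hgi := (IsIrreducible.injective_or_eq_zero g).resolve_right hg
  obtain ⟨v, hv⟩ := exists_ne (0 : N)
  have hgv : g v ≠ 0 := fun h0 => hv (hgi (by rw [h0, map_zero]))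
  have key : (σ.asAlgebraHom c).baseChange ℂ (g v) = ω c • g v := by
    rw [← ratAction_extend, ← ratAction_comm, hω, map_smul]
  constructor
  · intro h0
    rw [h0, zero_smul] at key
    have hz : (c : ℚ[G]) ∈ Submonoid.center ℚ[G] := by
      rw [Submonoid.mem_center_iff]
      exact Subalgebra.mem_center_iff.1 c.2
    let T : IntertwiningMap σ σ := IntertwiningMap.centralAlgebraMul σ hz
    -- By Schur's lemma `c` acts on `V` invertibly or as zero. An invertible action stays invertible
    -- over `ℂ`, so it cannot kill `g v ≠ 0`.
    rcases IsIrreducible.bijective_or_eq_zero T with hb | h1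
    · exfalso
      let e : V ≃ₗ[ℚ] V := LinearEquiv.ofBijective (σ.asAlgebraHom c) hb
      have h2 : (LinearMap.baseChange ℂ e.symm.toLinearMap)
          ((σ.asAlgebraHom c).baseChange ℂ (g v)) = g v := by
        rw [← LinearMap.comp_apply, ← LinearMap.baseChange_comp]
        have : e.symm.toLinearMap ∘ₗ σ.asAlgebraHom c = LinearMap.id := by
          ext x
          exact e.symm_apply_apply x
        simp [this]
      rw [key, map_zero] at h2
      exact hgv h2.symm
    · exact congrArg IntertwiningMap.toLinearMap h1
  · intro h0
    rw [h0, LinearMap.baseChange_zero, LinearMap.zero_apply] at key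
    exact (smul_eq_zero.1 key.symm).resolve_right hgv

/-- With inversion in place of conjugation, the pairing can be transported by an arbitrary
automorphism of `ℂ`, which need not commute with complex conjugation. -/
theorem charInner_eq_sum_inv (φ : G → ℂ) {N : Type*} [AddCommGroup N] [Module ℂ N]
    [FiniteDimensional ℂ N] (τ : Representation ℂ G N) :
    charInner φ τ.character = (Fintype.card G : ℂ)⁻¹ * ∑ g, φ g * τ.character g⁻¹ := by
  simp_rw [charInner, conj_character]

/-- The complex constituents of an irreducible rational representation all occur with the same
multiplicity. -/
theorem charInner_eq_of_isConstituent {V : Type*} [AddCommGroup V] [Module ℚ V]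
    [FiniteDimensional ℚ V] {σ : Representation ℚ G V} (hσ : σ.IsIrreducible) {χ ψ : G → ℂ}
    (hχ : IsConstituent χ σ) (hψ : IsConstituent ψ σ) :
    charInner (complexCharacter σ) χ = charInner (complexCharacter σ) ψ := by
  obtain ⟨m, hm⟩ := exists_natCast_eq_charInner σ hχ.1
  have hχ1 := charInner_self_of_mem_Irr hχ.1
  have hψ1 := charInner_self_of_mem_Irr hψ.1
  obtain ⟨⟨n₁, τ₁, hτ₁, rfl⟩, h₁⟩ := hχ
  obtain ⟨⟨n₂, τ₂, hτ₂, rfl⟩, h₂⟩ := hψ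
  obtain ⟨ω₁, hω₁⟩ := exists_centralCharacter τ₁ hτ₁
  obtain ⟨ω₂, hω₂⟩ := exists_centralCharacter τ₂ hτ₂
  -- Both kernels are the annihilator of `V` in the center, so an automorphism `s` of `ℂ` carries
  -- `ω₁` to `ω₂`.
  have hker : RingHom.ker ω₁ = RingHom.ker ω₂ := by
    refine Ideal.ext fun c => ?_
    rw [RingHom.mem_ker, RingHom.mem_ker, centralCharacter_eq_zero_iff hσ hτ₁ h₁ hω₁,
      centralCharacter_eq_zero_iff hσ hτ₂ h₂ hω₂]
  have hcount : Cardinal.mk (Subalgebra.center ℚ ℚ[G]) ≤ Cardinal.aleph0 := by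
    have : Countable ℚ[G] := (MonoidAlgebra.coeffLinearEquiv ℚ).injective.countable
    exact Cardinal.mk_le_aleph0
  obtain ⟨s, hs⟩ := exists_ringEquiv_comp_eq hcount ω₁ ω₂ hker
  have hG : (Fintype.card G : ℂ) ≠ 0 := by simp
  have val : ∀ {n : ℕ} {τ : Representation ℂ G (Fin n → ℂ)} {ω : Subalgebra.center ℚ ℚ[G] →+* ℂ},
      (∀ (c : Subalgebra.center ℚ ℚ[G]) v, ratAction τ c v = ω c • v) → ∀ g,
      (Fintype.card G : ℂ) * τ.character g = ω (classSum g) * n := by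
    intro n τ ω hω g
    rw [← trace_ratAction_classSum,
      show ratAction τ (classSum g) = ω (classSum g) • LinearMap.id from LinearMap.ext (hω _)]
    simp
  have hprop : ∀ g, n₁ * τ₂.character g = n₂ * s (τ₁.character g) := by
    intro g
    have e1 := congrArg s (val hω₁ g)
    rw [map_mul, map_mul, hs, map_natCast, map_natCast] at e1
    have e2 := val hω₂ g
    apply mul_left_cancel₀ hG
    linear_combination (n₁ : ℂ) * e2 - (n₂ : ℂ) * e1
  -- At this point the characters are conjugate only up to the ratio of degrees; since both have
  -- norm `1`, that ratio is `1`.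
  have hn : (n₁ : ℂ) = n₂ := by
    rw [charInner_eq_sum_inv, inv_mul_eq_one₀ hG] at hχ1 hψ1
    have e1 := congrArg s hχ1
    rw [map_natCast, map_sum] at e1
    have e2 : (n₁ : ℂ) ^ 2 * Fintype.card G = n₂ ^ 2 * Fintype.card G := by
      conv_lhs => rw [hψ1]
      conv_rhs => rw [e1]
      rw [Finset.mul_sum, Finset.mul_sum]
      refine Finset.sum_congr rfl fun g _ => ?_
      rw [map_mul]
      linear_combination (n₁ * τ₂.character g⁻¹) * hprop g + (n₂ * s (τ₁.character g)) * hprop g⁻¹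
    have e3 := mul_right_cancel₀ hG e2
    norm_cast at e3 ⊢
    exact Nat.pow_left_injective two_ne_zero e3
  have hn0 : (n₂ : ℂ) ≠ 0 := by
    have := nontrivial_of_isIrreducible hτ₂
    rw [Nat.cast_ne_zero]
    rintro rfl
    exact not_subsingleton (Fin 0 → ℂ) inferInstance
  have hχψ : ∀ g, τ₂.character g = s (τ₁.character g) := fun g =>
    mul_left_cancel₀ hn0 (by rw [← hprop, hn])
  -- The multiplicity is a natural number and `σ` has rational character values; `s` fixes both.
  rw [hm, ← map_natCast s, ← hm, charInner_eq_sum_inv, charInner_eq_sum_inv, map_mul, map_inv₀,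
    map_natCast, map_sum]
  congr 1
  refine Finset.sum_congr rfl fun g _ => ?_
  rw [map_mul, hχψ]
  congr 1
  simp [complexCharacter]

end CentralCharacter

/-! ### Well-definedness of the Schur index -/

section SchurIndex

variable {G : Type*} [Group G] [Fintype G]

/-- Irreducible rational representations containing `χ` are all equivalent, so the infimum is over a
singleton; transporting `σ` to coordinates shows that the set is inhabited. -/
theorem schurIndex_eq {V : Type*} [AddCommGroup V] [Module ℚ V]
    [FiniteDimensional ℚ V] {σ : Representation ℚ G V} (hσ : σ.IsIrreducible) {χ : G → ℂ}
    (hχ : IsConstituent χ σ) {m : ℕ} (hm : charInner (complexCharacter σ) χ = m) :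
    schurIndex ℚ χ = m := by
  have hset : {m : ℕ | ∃ (n : ℕ) (σ : Representation ℚ G (Fin n → ℚ)), σ.IsIrreducible ∧
      IsConstituent χ σ ∧ charInner (complexCharacter σ) χ = (m : ℂ)} = {m} := by
    ext k
    simp only [Set.mem_ofPred_eq, Set.mem_singleton_iff]
    constructor
    · rintro ⟨n, τ, hτ, hχτ, hk⟩
      obtain ⟨e⟩ := nonempty_equiv_of_isConstituent hσ hτ hχ hχτ
      rw [← complexCharacter_equiv e, hm] at hk
      exact_mod_cast hk.symm
    · rintro rfl
      let e := (Module.finBasis ℚ V).equivFun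
      let τ : Representation ℚ G (Fin (Module.finrank ℚ V) → ℚ) :=
        e.conjAlgEquiv ℚ |>.toAlgHom.toMonoidHom.comp σ
      let E : Representation.Equiv σ τ := .mk e fun g => by
        ext x
        simp [τ, LinearEquiv.conjAlgEquiv]
      refine ⟨_, τ, isIrreducible_of_equiv E.symm hσ, ⟨hχ.1, ?_⟩, ?_⟩
      · rw [← complexCharacter_equiv E]
        exact hχ.2
      · rw [← complexCharacter_equiv E, hm]
  rw [schurIndex, hset, csInf_singleton]

/-- Again the infimum is over a singleton, now because all constituents of `σ` have the same
multiplicity. -/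
theorem rationalSchurIndex_eq {V : Type*} [AddCommGroup V] [Module ℚ V]
    [FiniteDimensional ℚ V] {σ : Representation ℚ G V} (hσ : σ.IsIrreducible) {χ : G → ℂ}
    (hχ : IsConstituent χ σ) {m : ℕ} (hm : charInner (complexCharacter σ) χ = m) :
    rationalSchurIndex σ = m := by
  have hset : {m : ℕ | ∃ χ : G → ℂ, IsConstituent χ σ ∧ m = schurIndex ℚ χ} = {m} := by
    ext k
    simp only [Set.mem_ofPred_eq, Set.mem_singleton_iff]
    constructor
    · rintro ⟨ψ, hψ, rfl⟩
      exact schurIndex_eq hσ hψ (by rw [← hm, charInner_eq_of_isConstituent hσ hψ hχ])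
    · rintro rfl
      exact ⟨χ, hχ, (schurIndex_eq hσ hχ hm).symm⟩
  rw [rationalSchurIndex, hset, csInf_singleton]

end SchurIndex

/-! ### Multiplicities of simple components -/

section Multiplicity

variable {G : Type*} [Group G]

/-- The `a`-fold direct power of a representation. -/
def power {k V : Type*} [Field k] [AddCommGroup V] [Module k V] (ρ : Representation k G V)
    (a : ℕ) : Representation k G (Fin a → V) where
  toFun g := LinearMap.pi fun i => ρ g ∘ₗ LinearMap.proj i
  map_one' := by ext; simp
  map_mul' g h := by ext; simp

theorem character_power {k V : Type*} [Field k] [AddCommGroup V] [Module k V]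
    [FiniteDimensional k V] (ρ : Representation k G V) (a : ℕ) (g : G) :
    (power ρ a).character g = a * ρ.character g := by
  induction a with
  | zero => simp [Representation.character, Subsingleton.elim (power ρ 0 g) 0]
  | succ a ih =>
    let e : Representation.Equiv (ρ.prod (power ρ a)) (power ρ (a + 1)) :=
      .mk (Fin.consLinearEquiv k fun _ => V) fun h => by
        refine LinearMap.ext fun x => funext fun i => ?_
        refine Fin.cases ?_ (fun j => ?_) i <;> simp [power]
    rw [← char_iso e, character_prod, ih]
    push_cast
    ring

theorem nonempty_equiv_power {k V W : Type*} [Field k] [AddCommGroup V] [Module k V]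
    [AddCommGroup W] [Module k W] {ρ : Representation k G V} {σ : Representation k G W}
    {a : ℕ} (e : σ.asModule ≃ₗ[k[G]] (Fin a → ρ.asModule)) :
    Nonempty (Representation.Equiv σ (power ρ a)) := by
  refine ⟨.mk (V := W) (W := Fin a → V) (e.restrictScalars k) fun g => ?_⟩
  refine LinearMap.ext fun v => ?_
  have h1 := e.map_smul (MonoidAlgebra.single g (1 : k)) (σ.asModuleEquiv.symm v)
  rw [single_smul, one_smul] at h1
  refine h1.trans (funext fun i => ?_)
  rw [Pi.smul_apply, single_smul, one_smul]
  rfl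

variable [Fintype G]

/-- Split off the `V`-isotypic part, a power of `V`. If `χ` occurred in the complement, so would a
copy of `V`, which must lie in the isotypic part. -/
theorem charInner_eq_simpleMultiplicity_mul {W : Type*} [AddCommGroup W] [Module ℚ W]
    [FiniteDimensional ℚ W] (σ : Representation ℚ G W) (V : Subrepresentation σ)
    (hV : V.toRepresentation.IsIrreducible) {χ : G → ℂ}
    (hχ : IsConstituent χ V.toRepresentation) :
    charInner (complexCharacter σ) χ =
      simpleMultiplicity ℚ[G] σ.asModule V.asSubmodule *
        charInner (complexCharacter V.toRepresentation) χ := by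
  have : IsSimpleModule ℚ[G] V.asSubmodule :=
    (LinearEquiv.isSimpleModule_iff (R := ℚ[G]) (M := V.toRepresentation.asModule)
      (N := V.asSubmodule) (asModuleEquivAsSubmodule V)).1
      ((irreducible_iff_isSimpleModule_asModule _).1 hV)
  have : NeZero (Nat.card G : ℚ) := ⟨Nat.cast_ne_zero.2 Nat.card_pos.ne'⟩
  set a := simpleMultiplicity ℚ[G] σ.asModule V.asSubmodule with ha
  set I := isotypicComponent ℚ[G] σ.asModule V.asSubmodule with hI
  have : IsNoetherian ℚ[G] σ.asModule := isNoetherian_of_tower ℚ inferInstance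
  obtain ⟨e⟩ : Nonempty (I ≃ₗ[ℚ[G]] (Fin a → V.asSubmodule)) := by
    -- The infimum of a nonempty set of naturals is attained, so `a` itself is an exponent.
    apply Nat.sInf_mem (s := {k : ℕ | Nonempty (I ≃ₗ[ℚ[G]] (Fin k → V.asSubmodule))})
    exact (IsIsotypicOfType.isotypicComponent ℚ[G] σ.asModule V.asSubmodule).linearEquiv_fun
  let S : Subrepresentation σ := Subrepresentation.ofSubmodule' I
  obtain ⟨E⟩ := nonempty_equiv_power (ρ := V.toRepresentation) (σ := S.toRepresentation)
    ((asModuleEquivAsSubmodule S).trans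
      (e.trans (LinearEquiv.piCongrRight fun _ => (asModuleEquivAsSubmodule V).symm)))
  obtain ⟨T, u, hu⟩ := exists_equiv_prod_of_injective (inclusion S) (inclusion_injective S)
  have hT : charInner (complexCharacter T.toRepresentation) χ = 0 := by
    by_contra h0
    obtain ⟨R, hR, hRχ⟩ := exists_subrepresentation_isConstituent T.toRepresentation ⟨hχ.1, h0⟩
    obtain ⟨w⟩ := nonempty_equiv_of_isConstituent hV hR hχ hRχ
    let f : IntertwiningMap V.toRepresentation T.toRepresentation :=
      (inclusion R).comp w.toIntertwiningMap
    have hf : Function.Injective f :=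
      (inclusion_injective R).comp w.toLinearEquiv.injective
    let g : IntertwiningMap V.toRepresentation σ := (inclusion T).comp f
    have hg : Function.Injective g := (inclusion_injective T).comp hf
    have hgI : g.range.asSubmodule ≤ I :=
      le_sSup ⟨(asModuleEquivAsSubmodule g.range).symm.trans
        ((asModuleCongr (equivRange g hg).symm).trans (asModuleEquivAsSubmodule V))⟩
    have := nontrivial_of_isIrreducible hV
    obtain ⟨x, hx⟩ := exists_ne (0 : V.toSubmodule)
    have hgx : g x ∈ I := hgI ⟨x, rfl⟩
    -- The same vector, seen once in the isotypic part and once in the complement.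
    have h1 : u (⟨g x, hgx⟩, 0) = u (0, f x) := by
      rw [hu, hu]
      simp only [map_zero, zero_add]
      exact add_zero (g x)
    have h2 := congrArg Prod.snd (u.toLinearEquiv.injective h1)
    exact hx (hf (h2.symm.trans (map_zero f).symm))
  have hS : complexCharacter S.toRepresentation =
      fun g => (a : ℂ) * complexCharacter V.toRepresentation g := by
    rw [complexCharacter_equiv E]
    ext g
    simp [complexCharacter, character_power]
  rw [← complexCharacter_equiv u, complexCharacter_prod, charInner_add, hT, add_zero, hS]
  simp only [charInner, Finset.mul_sum]
  refine Finset.sum_congr rfl fun g _ => by ring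

/-- For rational representations, the parity condition on the multiplicities of simple components
amounts to a parity condition on the multiplicities of complex constituents of real type. -/
theorem forall_even_simpleMultiplicity_iff {W : Type*} [AddCommGroup W] [Module ℚ W]
    [FiniteDimensional ℚ W] (σ : Representation ℚ G W) :
    (∀ V : Subrepresentation σ, V.toRepresentation.IsIrreducible →
      IsRealType V.toRepresentation → Odd (rationalSchurIndex V.toRepresentation) →
      Even (simpleMultiplicity ℚ[G] σ.asModule V.asSubmodule)) ↔
    ∀ χ ∈ Irr G, frobeniusSchur χ = 1 →
      ∃ m : ℕ, Even m ∧ charInner (complexCharacter σ) χ = m := by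
  constructor
  · intro h χ hχ hν
    by_cases h0 : charInner (complexCharacter σ) χ = 0
    · exact ⟨0, by simp, by simpa using h0⟩
    obtain ⟨V, hV, hVχ⟩ := exists_subrepresentation_isConstituent σ ⟨hχ, h0⟩
    obtain ⟨m, hm⟩ := exists_natCast_eq_charInner V.toRepresentation hχ
    refine ⟨simpleMultiplicity ℚ[G] σ.asModule V.asSubmodule * m, ?_, ?_⟩
    · rw [Nat.even_mul, or_iff_not_imp_right, Nat.not_even_iff_odd]
      intro hodd
      exact h V hV ⟨χ, hVχ, hν⟩ (by rwa [rationalSchurIndex_eq hV hVχ hm])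
    · rw [charInner_eq_simpleMultiplicity_mul σ V hV hVχ, hm]
      push_cast
      rfl
  · rintro h V hV ⟨χ, hVχ, hν⟩ hodd
    obtain ⟨m, hm⟩ := exists_natCast_eq_charInner V.toRepresentation hVχ.1
    rw [rationalSchurIndex_eq hV hVχ hm] at hodd
    obtain ⟨k, hk, hkχ⟩ := h χ hVχ.1 hν
    rw [charInner_eq_simpleMultiplicity_mul σ V hV hVχ, hm] at hkχ
    have : simpleMultiplicity ℚ[G] σ.asModule V.asSubmodule * m = k := by exact_mod_cast hkχ
    rw [← this, Nat.even_mul] at hk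
    exact hk.resolve_right (Nat.not_even_iff_odd.2 hodd)

end Multiplicity

/-! ### The Frobenius–Schur indicator -/

section FrobeniusSchur

variable {G : Type*} [Group G] [Fintype G]

open Matrix

theorem mul_single_mul_apply {n R : Type*} [Fintype n] [DecidableEq n] [CommRing R]
    (M N : Matrix n n R) (a b i j : n) :
    (M * Matrix.single i j 1 * N : Matrix n n R) a b = M a i * N j b := by
  rw [mul_assoc, Matrix.mul_apply, Finset.sum_eq_single i]
  · simp
  · intro x _ hx
    simp [hx]
  · simp

/-- Irreducible characters with nonzero Frobenius-Schur indicator are real valued. -/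
theorem apply_inv_eq_of_frobeniusSchur_ne_zero {χ : G → ℂ} (hχ : χ ∈ Irr G)
    (h : frobeniusSchur χ ≠ 0) (g : G) : χ g⁻¹ = χ g := by
  obtain ⟨n, τ, hτ, rfl⟩ := hχ
  let A : G →* Matrix (Fin n) (Fin n) ℂ :=
    (LinearMap.toMatrixAlgEquiv' (R := ℂ) (n := Fin n)).toAlgHom.toMonoidHom.comp τ
  have hA : ∀ g, τ g = Matrix.toLin' (A g) := fun g => (Matrix.toLin'_toMatrix' (τ g)).symm
  have htr : ∀ g, τ.character g = (A g).trace := fun g => by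
    rw [Representation.character, hA, Matrix.trace_toLin'_eq]
  let τ' : Representation ℂ G (Fin n → ℂ) :=
    { toFun := fun g => Matrix.toLin' (A g⁻¹)ᵀ
      map_one' := by simp; rfl
      map_mul' := fun g h => by
        rw [_root_.mul_inv_rev, map_mul, Matrix.transpose_mul, Matrix.toLin'_mul]; rfl }
  -- `τ'` is the dual of `τ`, and averaging makes `S X` an intertwiner from `τ'` to `τ`. If all `S
  -- X` vanish, elementary matrices `X` give `ν₂ = 0`; otherwise Schur's lemma makes `τ` self-dual.
  let S : Matrix (Fin n) (Fin n) ℂ → Matrix (Fin n) (Fin n) ℂ :=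
    fun X => ∑ g, A g * X * (A g)ᵀ
  have hS : ∀ X h, S X * (A h⁻¹)ᵀ = A h * S X := by
    intro X h
    simp only [S, Finset.sum_mul, Finset.mul_sum]
    conv_lhs => rw [← Equiv.sum_comp (Equiv.mulLeft h)]
    refine Finset.sum_congr rfl fun x _ => ?_
    rw [mul_assoc, ← Matrix.transpose_mul, ← map_mul]
    simp [mul_assoc]
  by_cases hX : ∀ X, S X = 0
  · refine absurd ?_ h
    have h1 : ∀ i j, ∑ g, A g i j * A g j i = 0 := by
      intro i j
      have := congrFun (congrFun (hX (Matrix.single j i 1)) i) j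
      simpa only [S, Matrix.sum_apply, mul_single_mul_apply, Matrix.transpose_apply,
        Matrix.zero_apply] using this
    have h2 : ∀ g, τ.character (g ^ 2) = ∑ i, ∑ j, A g i j * A g j i := by
      intro g
      rw [htr, pow_two, map_mul, Matrix.trace]
      simp [Matrix.mul_apply]
    simp_rw [frobeniusSchur, h2]
    rw [Finset.sum_comm]
    simp_rw [Finset.sum_comm (s := (Finset.univ : Finset G)), h1]
    simp
  · push Not at hX
    obtain ⟨X, hX⟩ := hX
    let f : IntertwiningMap τ' τ := ⟨Matrix.toLin' (S X), fun g => by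
      rw [hA]
      change Matrix.toLin' (S X) ∘ₗ Matrix.toLin' (A g⁻¹)ᵀ = _
      rw [← Matrix.toLin'_mul, ← Matrix.toLin'_mul, hS]⟩
    have hf : f ≠ 0 := fun h0 => hX (by
      have := congrArg IntertwiningMap.toLinearMap h0
      exact Matrix.toLin'.map_eq_zero_iff.1 this)
    have hs : Function.Surjective f.toLinearMap :=
      (IsIrreducible.surjective_or_eq_zero f).resolve_right hf
    let e := f.ofBijective ⟨LinearMap.injective_iff_surjective.2 hs, hs⟩
    rw [htr, ← Matrix.trace_transpose, ← Matrix.trace_toLin'_eq]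
    exact congrFun (char_iso e) g

/-- A real representation whose only equivariant endomorphisms are the scalars has
Frobenius-Schur indicator `1`. -/
theorem frobeniusSchur_eq_one {V : Type*} [AddCommGroup V] [Module ℝ V] [FiniteDimensional ℝ V]
    (σ : Representation ℝ G V) (h : Module.finrank ℝ (IntertwiningMap σ σ) = 1) :
    frobeniusSchur (complexCharacter σ) = 1 := by
  classical
  let b := Module.finBasis ℝ V
  let n := Module.finrank ℝ V
  let A : G →* Matrix (Fin n) (Fin n) ℝ := (LinearMap.toMatrixAlgEquiv b).toAlgHom.toMonoidHom.comp σ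
  have htr : ∀ g, σ.character g = (A g).trace := fun g => LinearMap.trace_eq_matrix_trace ℝ b (σ g)
  have hV : Nontrivial V := by
    by_contra hs
    rw [not_nontrivial_iff_subsingleton] at hs
    have : Subsingleton (IntertwiningMap σ σ) :=
      ⟨fun f g => DFunLike.ext _ _ fun x => Subsingleton.elim _ _⟩
    simp [Module.finrank_zero_of_subsingleton] at h
  have hn : (n : ℝ) ≠ 0 := Nat.cast_ne_zero.2 Module.finrank_pos.ne'
  have hid : (1 : IntertwiningMap σ σ) ≠ 0 := by
    intro h0
    obtain ⟨v, hv⟩ := exists_ne (0 : V)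
    exact hv (DFunLike.congr_fun h0 v)
  have scalar : ∀ X : Matrix (Fin n) (Fin n) ℝ, ∃ c : ℝ, ∑ g, A g * X * A g⁻¹ = c • 1 := by
    intro X
    have hc : ∀ k, (∑ g, A g * X * A g⁻¹) * A k = A k * ∑ g, A g * X * A g⁻¹ := by
      intro k
      rw [Finset.sum_mul, Finset.mul_sum]
      conv_lhs => rw [← Equiv.sum_comp (Equiv.mulLeft k)]
      refine Finset.sum_congr rfl fun x _ => ?_
      rw [mul_assoc, ← map_mul]
      simp [mul_assoc]
    let f : IntertwiningMap σ σ := ⟨(LinearMap.toMatrixAlgEquiv b).symm (∑ g, A g * X * A g⁻¹),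
      fun k => by
        have h1 : σ k = (LinearMap.toMatrixAlgEquiv b).symm (A k) :=
          ((LinearMap.toMatrixAlgEquiv b).symm_apply_apply (σ k)).symm
        rw [h1, ← Module.End.mul_eq_comp, ← Module.End.mul_eq_comp, ← map_mul, ← map_mul, hc]⟩
    obtain ⟨c, hc⟩ := (finrank_eq_one_iff_of_nonzero' _ hid).1 h f
    refine ⟨c, (LinearMap.toMatrixAlgEquiv b).symm.injective ?_⟩
    rw [map_smul, map_one]
    exact (congrArg IntertwiningMap.toLinearMap hc).symm
  -- Schur orthogonality: the average of an elementary matrix is a scalar, and its trace determines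
  -- the scalar.
  have schur : ∀ i l k j, (n : ℝ) * ∑ g, A g i l * A g⁻¹ k j =
      if l = k ∧ i = j then (Fintype.card G : ℝ) else 0 := by
    intro i l k j
    obtain ⟨c, hc⟩ := scalar (Matrix.single l k 1)
    have h1 := congrArg Matrix.trace hc
    have h2 := congrFun (congrFun hc i) j
    simp only [Matrix.sum_apply, mul_single_mul_apply, Matrix.smul_apply, Matrix.one_apply] at h2
    have h3 : ∀ g, (A g * Matrix.single l k 1 * A g⁻¹).trace = if l = k then 1 else 0 := by
      intro g
      rw [Matrix.trace_mul_cycle, ← map_mul, inv_mul_cancel, map_one, one_mul]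
      split_ifs with hlk
      · rw [hlk, Matrix.trace_single_eq_same]
      · rw [Matrix.trace_single_eq_of_ne _ _ _ hlk]
    simp only [Matrix.trace_sum, h3, Matrix.trace_smul, Matrix.trace_one, Finset.sum_const,
      Finset.card_univ, nsmul_eq_mul, Fintype.card_fin, smul_eq_mul] at h1
    rw [h2, ite_and]
    by_cases hij : i = j <;> by_cases hlk : l = k <;> simp_all [mul_comm]
  obtain ⟨B, hB, hBt, hAB⟩ := exists_invariant_form A
  obtain ⟨u, rfl⟩ := hB
  set B : Matrix (Fin n) (Fin n) ℝ := (u : Matrix (Fin n) (Fin n) ℝ)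
  set C : Matrix (Fin n) (Fin n) ℝ :=
    ((u⁻¹ : (Matrix (Fin n) (Fin n) ℝ)ˣ) : Matrix (Fin n) (Fin n) ℝ)
  rw [Matrix.conjTranspose_eq_transpose_of_trivial] at hBt
  have hCB : C * B = 1 := Units.inv_mul u
  -- Rewriting one factor of `A g * A g` this way expresses the trace at `g ^ 2` through products of
  -- entries of `A g` and `A g⁻¹`, to which `schur` applies.
  have hA : ∀ g, A g = C * (A g⁻¹)ᵀ * B := by
    intro g
    have := hAB g⁻¹
    rw [Matrix.conjTranspose_eq_transpose_of_trivial, inv_inv] at this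
    rw [mul_assoc, this, ← mul_assoc, hCB, one_mul]
  have hsq : ∀ g, σ.character (g ^ 2) =
      ∑ l, ∑ i, ∑ k, ∑ j, C l j * B k i * (A g i l * A g⁻¹ k j) := by
    intro g
    have h1 : A (g ^ 2) = C * (A g⁻¹)ᵀ * B * A g := by rw [← hA g, pow_two, map_mul]
    rw [htr, h1, Matrix.trace]
    refine Finset.sum_congr rfl fun l _ => ?_
    rw [Matrix.diag_apply, Matrix.mul_apply]
    refine Finset.sum_congr rfl fun i _ => ?_
    rw [Matrix.mul_apply, Finset.sum_mul]
    refine Finset.sum_congr rfl fun k _ => ?_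
    rw [Matrix.mul_apply, Finset.sum_mul, Finset.sum_mul]
    refine Finset.sum_congr rfl fun j _ => ?_
    rw [Matrix.transpose_apply]
    ring
  have hsum : (n : ℝ) * ∑ g, σ.character (g ^ 2) = n * Fintype.card G := by
    have h1 : (n : ℝ) * ∑ g, σ.character (g ^ 2) = ∑ l, ∑ i, ∑ k, ∑ j, C l j * B k i *
        (n * ∑ g, A g i l * A g⁻¹ k j) := by
      simp_rw [hsq, Finset.mul_sum]
      rw [Finset.sum_comm]
      refine Finset.sum_congr rfl fun l _ => ?_
      rw [Finset.sum_comm]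
      refine Finset.sum_congr rfl fun i _ => ?_
      rw [Finset.sum_comm]
      refine Finset.sum_congr rfl fun k _ => ?_
      rw [Finset.sum_comm]
      refine Finset.sum_congr rfl fun j _ => Finset.sum_congr rfl fun g _ => ?_
      ring
    -- Symmetry of `B` gives the sign `+1`; a skew form would give `-1`.
    have h2 : (C * Bᵀ).trace = n := by
      rw [hBt, hCB, Matrix.trace_one, Fintype.card_fin]
    rw [h1]
    conv_rhs => rw [← h2]
    rw [Matrix.trace, Finset.sum_mul]
    refine Finset.sum_congr rfl fun l _ => ?_
    rw [Matrix.diag_apply, Matrix.mul_apply, Finset.sum_mul]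
    refine Finset.sum_congr rfl fun i _ => ?_
    simp [schur, ite_and]
  have hsum' := mul_left_cancel₀ hn hsum
  have h3 := congrArg (algebraMap ℝ ℂ) hsum'
  rw [map_sum, map_natCast] at h3
  rw [frobeniusSchur]
  simp only [complexCharacter]
  rw [h3, inv_mul_cancel₀ (by simp)]

end FrobeniusSchur

/-! ### Complex structures and endomorphism rings -/

section HasJ

variable {k G : Type*} [Field k] [Group G]
variable {V W : Type*} [AddCommGroup V] [Module k V] [AddCommGroup W] [Module k W]

/-- A representation has a complex structure if it has an equivariant endomorphism of
square `-1`. -/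
def HasComplexStructure (σ : Representation k G V) : Prop :=
  ∃ J : IntertwiningMap σ σ, ∀ v, J (J v) = -v

theorem HasComplexStructure.of_equiv {σ : Representation k G V} {τ : Representation k G W}
    (e : Representation.Equiv σ τ) (h : HasComplexStructure σ) : HasComplexStructure τ := by
  obtain ⟨J, hJ⟩ := h
  refine ⟨(e.toIntertwiningMap.comp J).comp e.symm.toIntertwiningMap, fun v => ?_⟩
  simp [hJ]

theorem HasComplexStructure.prod {σ : Representation k G V} {τ : Representation k G W}
    (hσ : HasComplexStructure σ) (hτ : HasComplexStructure τ) :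
    HasComplexStructure (σ.prod τ) := by
  obtain ⟨J, hJ⟩ := hσ
  obtain ⟨K, hK⟩ := hτ
  refine ⟨⟨J.toLinearMap.prodMap K.toLinearMap, fun g => ?_⟩, fun v => ?_⟩
  · refine LinearMap.ext fun v => Prod.ext ?_ ?_
    · exact J.isIntertwining _ _ g v.1
    · exact K.isIntertwining _ _ g v.2
  · exact Prod.ext (hJ v.1) (hK v.2)

/-- Two equal summands are rotated by `(x, y) ↦ (-y, x)`, whatever `σ` is. The nesting matches the
removal of two copies one after the other. -/
theorem HasComplexStructure.prod_prod (σ : Representation k G V) {τ : Representation k G W}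
    (hτ : HasComplexStructure τ) : HasComplexStructure (σ.prod (σ.prod τ)) := by
  obtain ⟨K, hK⟩ := hτ
  let J : V × V × W →ₗ[k] V × V × W :=
    { toFun := fun x => (-x.2.1, x.1, K x.2.2)
      map_add' := fun x y => by simp [add_comm]
      map_smul' := fun c x => by simp }
  refine ⟨⟨J, fun g => ?_⟩, fun v => ?_⟩
  · refine LinearMap.ext fun v => Prod.ext ?_ (Prod.ext ?_ ?_)
    · exact (map_neg (σ g) v.2.1).symm
    · rfl
    · exact K.isIntertwining _ _ g v.2.2
  · exact Prod.ext rfl (Prod.ext rfl (hK v.2.2))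

/-- The projection onto a simple summand is a scalar and fixes a nonzero vector, so it is the
identity and the complement vanishes. -/
theorem isIrreducible_of_finrank_eq_one [CharZero k] [Finite G] {σ : Representation k G V}
    (h : Module.finrank k (IntertwiningMap σ σ) = 1) : σ.IsIrreducible := by
  have hV : Nontrivial V := by
    by_contra hs
    rw [not_nontrivial_iff_subsingleton] at hs
    have : Subsingleton (IntertwiningMap σ σ) :=
      ⟨fun f g => DFunLike.ext _ _ fun x => Subsingleton.elim _ _⟩
    simp [Module.finrank_zero_of_subsingleton] at h
  have hid : (1 : IntertwiningMap σ σ) ≠ 0 := by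
    intro h0
    obtain ⟨v, hv⟩ := exists_ne (0 : V)
    exact hv (DFunLike.congr_fun h0 v)
  obtain ⟨S, hS⟩ := exists_isIrreducible_subrepresentation σ
  obtain ⟨T, e, he⟩ := exists_equiv_prod_of_injective (inclusion S) (inclusion_injective S)
  let q : IntertwiningMap (S.toRepresentation.prod T.toRepresentation)
      (S.toRepresentation.prod T.toRepresentation) :=
    ⟨LinearMap.prodMap LinearMap.id 0, fun g => by
      refine LinearMap.ext fun v => Prod.ext rfl ?_
      simp⟩
  let p : IntertwiningMap σ σ := (e.toIntertwiningMap.comp q).comp e.symm.toIntertwiningMap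
  obtain ⟨c, hc⟩ := (finrank_eq_one_iff_of_nonzero' _ hid).1 h p
  have hp : ∀ x, c • e x = e (x.1, 0) := by
    intro x
    have h1 : c • e x = p (e x) := DFunLike.congr_fun hc (e x)
    rw [h1]
    simp [p]
    rfl
  have hS' := nontrivial_of_isIrreducible hS
  obtain ⟨s, hs⟩ := exists_ne (0 : S.toSubmodule)
  have hc1 : c = 1 := by
    have h1 := hp (s, 0)
    have h2 : e (s, 0) ≠ 0 := fun h0 =>
      hs (congrArg Prod.fst (e.toLinearEquiv.map_eq_zero_iff.1 h0))
    exact smul_left_injective k h2 (h1.trans (one_smul k _).symm)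
  have hT : ∀ t : T.toSubmodule, t = 0 := by
    intro t
    have h1 := hp (0, t)
    rw [hc1, one_smul] at h1
    exact congrArg Prod.snd (e.toLinearEquiv.injective h1)
  refine isIrreducible_of_equiv ((inclusion S).ofBijective
    ⟨inclusion_injective S, fun v => ?_⟩).symm hS
  refine ⟨(e.symm v).1, ?_⟩
  have h1 := he (e.symm v)
  rw [hT (e.symm v).2] at h1
  simpa using h1.symm

/-- An irreducible real representation has a complex structure or only scalar equivariant
endomorphisms. -/
theorem finrank_eq_one_of_not_hasComplexStructure {V : Type*} [AddCommGroup V] [Module ℝ V]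
    [FiniteDimensional ℝ V] {σ : Representation ℝ G V} (hσ : σ.IsIrreducible)
    (h : ¬ HasComplexStructure σ) : Module.finrank ℝ (IntertwiningMap σ σ) = 1 := by
  classical
  have hs := (irreducible_iff_isSimpleModule_asModule σ).1 hσ
  let φ := IntertwiningMap.equivAlgEnd (ρ := σ)
  have hV := nontrivial_of_isIrreducible hσ
  have hid : (1 : IntertwiningMap σ σ) ≠ 0 := by
    intro h0
    obtain ⟨v, hv⟩ := exists_ne (0 : V)
    exact hv (DFunLike.congr_fun h0 v)
  refine (finrank_eq_one_iff_of_nonzero' _ hid).2 fun f => ?_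
  have : Module.Finite ℝ (Module.End ℝ[G] σ.asModule) := Module.Finite.equiv φ.toLinearEquiv
  have hint : IsIntegral ℝ (φ f) := Algebra.IsIntegral.isIntegral _
  -- By Schur's lemma the endomorphisms form a division ring, so minimal polynomials are
  -- irreducible, hence of degree at most `2` over `ℝ`.
  have hirr : Irreducible (minpoly ℝ (φ f)) := minpoly.irreducible hint
  have hmonic := minpoly.monic hint
  have hdeg : (minpoly ℝ (φ f)).natDegree ≤ 2 := hirr.natDegree_le_two
  have hpos : 0 < (minpoly ℝ (φ f)).natDegree := minpoly.natDegree_pos hint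
  obtain h1 | h2 : (minpoly ℝ (φ f)).natDegree = 1 ∨ (minpoly ℝ (φ f)).natDegree = 2 := by omega
  · obtain ⟨c, hc⟩ := minpoly.natDegree_eq_one_iff.1 h1
    refine ⟨c, φ.injective ?_⟩
    rw [← hc, map_smul, map_one, Algebra.algebraMap_eq_smul_one]
  · exfalso
    set p := minpoly ℝ (φ f) with hp
    have hae : f * f + p.coeff 1 • f + p.coeff 0 • 1 = 0 := by
      apply φ.injective
      have h3 := minpoly.aeval ℝ (φ f)
      rw [← hp, Polynomial.aeval_eq_sum_range, h2] at h3
      simp only [Finset.sum_range_succ, Finset.sum_range_zero, zero_add, pow_zero, pow_one] at h3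
      have h4 : p.coeff 2 = 1 := by
        have := hmonic.coeff_natDegree
        rwa [h2] at this
      rw [h4, one_smul, pow_two] at h3
      simp only [map_add, map_mul, map_smul, map_one, map_zero]
      rw [← h3]
      abel
    set b := p.coeff 1
    set c := p.coeff 0
    by_cases hd : 0 ≤ b ^ 2 - 4 * c
    · have hroot : p.IsRoot ((-b + √(b ^ 2 - 4 * c)) / 2) := by
        rw [Polynomial.IsRoot, Polynomial.eval_eq_sum_range, h2]
        have h4 : p.coeff 2 = 1 := by
          have := hmonic.coeff_natDegree
          rwa [h2] at this
        simp only [Finset.sum_range_succ, Finset.sum_range_zero, zero_add, pow_zero, pow_one, h4]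
        have := Real.sq_sqrt hd
        change c * 1 + b * _ + 1 * _ = 0
        linear_combination this / 4
      have h5 := Polynomial.degree_eq_one_of_irreducible_of_root hirr hroot
      rw [Polynomial.degree_eq_natDegree hmonic.ne_zero, h2] at h5
      exact absurd (Nat.cast_injective (R := WithBot ℕ) (h5.trans Nat.cast_one.symm)) (by simp)
    · push Not at hd
      have hd' : 0 < 4 * c - b ^ 2 := by linarith
      set r := √(4 * c - b ^ 2)
      have hr : r ^ 2 = 4 * c - b ^ 2 := Real.sq_sqrt hd'.le
      have hr0 : r ≠ 0 := (Real.sqrt_pos.2 hd').ne'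
      -- Completing the square in `f² + b f + c = 0` gives `(2f + b)² = b² - 4c = -r²`.
      refine h ⟨r⁻¹ • ((2 : ℝ) • f + b • 1), fun v => ?_⟩
      have h5 : f (f v) = -(b • f v) - c • v := by
        have h6 : f (f v) + b • f v + c • v = 0 := DFunLike.congr_fun hae v
        rw [← sub_eq_zero, ← h6]
        abel
      have h7 : ∀ w, (r⁻¹ • ((2 : ℝ) • f + b • 1) : IntertwiningMap σ σ) w =
        r⁻¹ • ((2 : ℝ) • f w + b • w) := fun w => rfl
      rw [h7, h7]
      simp only [map_smul, map_add, h5]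
      have h8 : r⁻¹ ^ 2 * (4 * c - b ^ 2) = 1 := by
        rw [← hr]; field_simp
      match_scalars
      · ring
      · linear_combination (-1 : ℝ) * h8

end HasJ

/-! ### The criterion for complex structures on real representations -/

section RealCriterion

variable {G : Type*} [Group G]

/-- Complexifying a real representation with a complex structure yields a representation and its
complex conjugate. -/
theorem exists_complexCharacter_eq_add_conj {V : Type*} [AddCommGroup V] [Module ℝ V]
    [FiniteDimensional ℝ V] {σ : Representation ℝ G V} (h : HasComplexStructure σ) :
    ∃ K : Subrepresentation (extend ℂ σ), ∀ g, complexCharacter σ g =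
      K.toRepresentation.character g + (starRingEnd ℂ) (K.toRepresentation.character g) := by
  obtain ⟨J, hJ⟩ := h
  let JC : Module.End ℂ (ℂ ⊗[ℝ] V) := J.toLinearMap.baseChange ℂ
  have hJC : ∀ v, JC (JC v) = -v := by
    intro v
    have h1 : J.toLinearMap ∘ₗ J.toLinearMap = -LinearMap.id := LinearMap.ext hJ
    have h2 : JC ∘ₗ JC = -LinearMap.id := by
      rw [← LinearMap.baseChange_comp, h1, LinearMap.baseChange_neg, LinearMap.baseChange_id]
    exact LinearMap.congr_fun h2 v
  have hcomm : ∀ g v, JC (extend ℂ σ g v) = extend ℂ σ g (JC v) := by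
    intro g v
    have h2 : JC ∘ₗ extend ℂ σ g = extend ℂ σ g ∘ₗ JC := by
      change J.toLinearMap.baseChange ℂ ∘ₗ (σ g).baseChange ℂ =
        (σ g).baseChange ℂ ∘ₗ J.toLinearMap.baseChange ℂ
      rw [← LinearMap.baseChange_comp, ← LinearMap.baseChange_comp, J.isIntertwining']
    exact LinearMap.congr_fun h2 v
  let K : ℂ → Subrepresentation (extend ℂ σ) := fun z =>
    { toSubmodule := LinearMap.ker (JC - z • LinearMap.id)
      apply_mem_toSubmodule := fun g v hv => by
        rw [LinearMap.mem_ker, LinearMap.sub_apply, sub_eq_zero] at hv ⊢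
        rw [hcomm, hv]
        simp }
  have hK : ∀ z (v : (K z).toSubmodule), JC v = z • (v : ℂ ⊗[ℝ] V) := fun z v =>
    sub_eq_zero.1 v.2
  have hI := Complex.I_mul_I
  have hI0 := Complex.I_ne_zero
  let d : ((K Complex.I).toSubmodule × (K (-Complex.I)).toSubmodule) →ₗ[ℂ] ℂ ⊗[ℝ] V :=
    (K Complex.I).toSubmodule.subtype.coprod (K (-Complex.I)).toSubmodule.subtype
  have hd : ∀ x, d x = (x.1 : ℂ ⊗[ℝ] V) + x.2 := fun x => rfl
  have hdb : Function.Bijective d := by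
    constructor
    · rw [← LinearMap.ker_eq_bot, LinearMap.ker_eq_bot']
      intro x hx
      rw [hd] at hx
      have h1 := congrArg JC hx
      rw [map_add, hK, hK, map_zero, neg_smul, ← smul_neg, ← smul_add] at h1
      have h2 := (smul_eq_zero.1 h1).resolve_left hI0
      have e1 : (x.1 : ℂ ⊗[ℝ] V) = 0 := by
        have : (2 : ℂ) • (x.1 : ℂ ⊗[ℝ] V) = 0 := by
          have h3 : (2 : ℂ) • (x.1 : ℂ ⊗[ℝ] V) = ((x.1 : ℂ ⊗[ℝ] V) + x.2) + (x.1 + -x.2) := by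
            module
          rw [h3, hx, h2, add_zero]
        exact (smul_eq_zero.1 this).resolve_left two_ne_zero
      have e2 : (x.2 : ℂ ⊗[ℝ] V) = 0 := by rwa [e1, zero_add] at hx
      exact Prod.ext (Subtype.ext e1) (Subtype.ext e2)
    · intro v
      -- The projections onto the `i` and `-i` eigenspaces of `JC`.
      refine ⟨(⟨(1 / 2 : ℂ) • (v - Complex.I • JC v), ?_⟩,
        ⟨(1 / 2 : ℂ) • (v + Complex.I • JC v), ?_⟩), ?_⟩
      · change _ ∈ LinearMap.ker _
        rw [LinearMap.mem_ker]
        simp only [LinearMap.sub_apply, map_smul, map_sub, hJC, LinearMap.smul_apply,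
          LinearMap.id_apply]
        match_scalars <;> first | ring1 | linear_combination (1 / 2 : ℂ) * hI
      · change _ ∈ LinearMap.ker _
        rw [LinearMap.mem_ker]
        simp only [LinearMap.sub_apply, map_smul, map_add, hJC, LinearMap.smul_apply,
          LinearMap.id_apply]
        match_scalars <;> first | ring1 | linear_combination (1 / 2 : ℂ) * hI
      · rw [hd]
        module
  let e := LinearEquiv.ofBijective d hdb
  have tr : ∀ (T : Module.End ℂ (ℂ ⊗[ℝ] V)) (T₁ : Module.End ℂ (K Complex.I).toSubmodule)
      (T₂ : Module.End ℂ (K (-Complex.I)).toSubmodule),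
      (∀ x, T (d x) = d (T₁ x.1, T₂ x.2)) →
      LinearMap.trace ℂ _ T = LinearMap.trace ℂ _ T₁ + LinearMap.trace ℂ _ T₂ := by
    intro T T₁ T₂ hT
    rw [← LinearMap.trace_prodMap', ← LinearMap.trace_conj' _ e]
    congr 1
    refine LinearMap.ext fun v => ?_
    obtain ⟨x, rfl⟩ := e.surjective v
    rw [LinearEquiv.conj_apply_apply, e.symm_apply_apply]
    exact hT x
  refine ⟨K Complex.I, fun g => ?_⟩
  set t₁ := (K Complex.I).toRepresentation.character g with ht₁
  set t₂ := (K (-Complex.I)).toRepresentation.character g with ht₂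
  have e1 : complexCharacter σ g = t₁ + t₂ := by
    rw [complexCharacter_eq_character_extend]
    refine tr _ _ _ fun x => ?_
    rw [hd, map_add]
    rfl
  -- The traces of `σ g` and `J ∘ σ g` are real, so `t₁ + t₂` and `i (t₁ - t₂)` are real; together
  -- these give `t₂ = conj t₁`.
  have e2 : ((LinearMap.trace ℝ V (J.toLinearMap ∘ₗ σ g) : ℝ) : ℂ) =
      Complex.I * t₁ - Complex.I * t₂ := by
    have h1 : LinearMap.trace ℂ _ (JC ∘ₗ extend ℂ σ g) =
        ((LinearMap.trace ℝ V (J.toLinearMap ∘ₗ σ g) : ℝ) : ℂ) := by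
      change LinearMap.trace ℂ _ (J.toLinearMap.baseChange ℂ ∘ₗ (σ g).baseChange ℂ) = _
      rw [← LinearMap.baseChange_comp, LinearMap.trace_baseChange]
      rfl
    rw [← h1, tr _ (Complex.I • (K Complex.I).toRepresentation g)
      ((-Complex.I) • (K (-Complex.I)).toRepresentation g), map_smul, map_smul]
    · simp only [smul_eq_mul, ht₁, ht₂, Representation.character]
      ring
    · intro x
      rw [hd, LinearMap.comp_apply, map_add, map_add]
      congr 1
      · exact hK _ ((K Complex.I).toRepresentation g x.1)
      · exact hK _ ((K (-Complex.I)).toRepresentation g x.2)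
  have e1' : (starRingEnd ℂ) (complexCharacter σ g) = complexCharacter σ g :=
    Complex.conj_ofReal _
  have e2' := congrArg (starRingEnd ℂ) e2
  rw [Complex.conj_ofReal, e2] at e2'
  rw [e1] at e1' ⊢
  simp only [map_add, map_sub, map_mul, Complex.conj_I] at e1' e2'
  have h3 : Complex.I * t₁ - Complex.I * t₂ =
    Complex.I * ((starRingEnd ℂ) t₂ - (starRingEnd ℂ) t₁) := by
    rw [e2']; ring
  rw [← mul_sub] at h3
  have h4 := mul_left_cancel₀ hI0 h3
  linear_combination (-1 / 2 : ℂ) * h4 - (1 / 2 : ℂ) * e1'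

variable [Fintype G]

/-- A real-valued `χ` pairs equally with the character of the `i`-eigenspace and with its conjugate,
so its multiplicity is `m + m`. -/
theorem exists_even_charInner_of_hasComplexStructure {V : Type*} [AddCommGroup V] [Module ℝ V]
    [FiniteDimensional ℝ V] {σ : Representation ℝ G V} (h : HasComplexStructure σ) {χ : G → ℂ}
    (hχ : χ ∈ Irr G) (hν : frobeniusSchur χ = 1) :
    ∃ m : ℕ, Even m ∧ charInner (complexCharacter σ) χ = m := by
  have hreal := apply_inv_eq_of_frobeniusSchur_ne_zero hχ (by rw [hν]; exact one_ne_zero)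
  obtain ⟨K, hK⟩ := exists_complexCharacter_eq_add_conj h
  obtain ⟨n, τ, hτ, rfl⟩ := hχ
  obtain ⟨m, hm⟩ : ∃ m : ℕ, charInner K.toRepresentation.character τ.character = m :=
    ⟨_, charInner_character _ _⟩
  refine ⟨m + m, ⟨m, rfl⟩, ?_⟩
  have h1 : complexCharacter σ = K.toRepresentation.character +
      fun g => (starRingEnd ℂ) (K.toRepresentation.character g) := funext hK
  have h2 : charInner (fun g => (starRingEnd ℂ) (K.toRepresentation.character g)) τ.character =
      (starRingEnd ℂ) (charInner K.toRepresentation.character τ.character) := by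
    simp only [charInner, map_mul, map_inv₀, map_natCast, map_sum]
    congr 1
    refine Finset.sum_congr rfl fun g _ => ?_
    rw [conj_character τ, conj_character τ, inv_inv, hreal]
  rw [h1, charInner_add, h2, hm, map_natCast, Nat.cast_add]

/-- Induction on dimension: remove a simple `S` that has a complex structure, or else two copies of
`S`. In both cases the removed part contributes evenly at each `χ` of indicator `1`, so the
hypothesis passes to the rest. -/
theorem hasComplexStructure_of_forall_even {V : Type*} [AddCommGroup V] [Module ℝ V]
    [FiniteDimensional ℝ V] (σ : Representation ℝ G V)
    (h : ∀ χ ∈ Irr G, frobeniusSchur χ = 1 →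
      ∃ m : ℕ, Even m ∧ charInner (complexCharacter σ) χ = m) : HasComplexStructure σ := by
  induction hn : Module.finrank ℝ V using Nat.strong_induction_on generalizing V with
  | _ n ih =>
  rcases subsingleton_or_nontrivial V with hV | hV
  · exact ⟨0, fun v => Subsingleton.elim _ _⟩
  obtain ⟨S, hS⟩ := exists_isIrreducible_subrepresentation σ
  have hS0 := nontrivial_of_isIrreducible hS
  have hSpos := Module.finrank_pos (R := ℝ) (M := S.toSubmodule)
  obtain ⟨T, e, -⟩ := exists_equiv_prod_of_injective (inclusion S) (inclusion_injective S)
  have hdim := e.toLinearEquiv.finrank_eq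
  rw [Module.finrank_prod] at hdim
  have hadd : ∀ χ, charInner (complexCharacter σ) χ =
      charInner (complexCharacter S.toRepresentation) χ +
      charInner (complexCharacter T.toRepresentation) χ := fun χ => by
    rw [← complexCharacter_equiv e, complexCharacter_prod, charInner_add]
  have parity : ∀ {a b c : ℂ} {i : ℕ}, Even i → a = i → (∃ j : ℕ, c = j) →
      (∃ m : ℕ, Even m ∧ b = m) → b = a + c → ∃ m : ℕ, Even m ∧ c = m := by
    rintro a b c i hi rfl ⟨j, rfl⟩ ⟨m, hm, rfl⟩ hb
    refine ⟨j, ?_, rfl⟩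
    have : m = i + j := by exact_mod_cast hb
    rw [this, Nat.even_add] at hm
    exact hm.1 hi
  by_cases hJ : HasComplexStructure S.toRepresentation
  · refine (hJ.prod (ih _ (by omega) T.toRepresentation (fun χ hχ hν => ?_) rfl)).of_equiv e
    obtain ⟨i, hi, hiχ⟩ := exists_even_charInner_of_hasComplexStructure hJ hχ hν
    exact parity hi hiχ (exists_natCast_eq_charInner _ hχ) (h χ hχ hν) (hadd χ)
  · have hone := finrank_eq_one_of_not_hasComplexStructure hS hJ
    -- The endomorphism space keeps its dimension `1` after complexification, so the latter is
    -- irreducible.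
    have hψ : complexCharacter S.toRepresentation ∈ Irr G := by
      rw [complexCharacter_eq_character_extend]
      refine character_mem_Irr _ (isIrreducible_of_finrank_eq_one ?_)
      have h1 := charInner_complexCharacter S.toRepresentation S.toRepresentation
      rw [hone, complexCharacter_eq_character_extend, charInner_character] at h1
      exact_mod_cast h1
    obtain ⟨m, hm, hmχ⟩ := h _ hψ (frobeniusSchur_eq_one _ hone)
    -- Without a second copy of `S` in `T`, the character of `S` would occur exactly once.
    have hT : Module.finrank ℝ (IntertwiningMap S.toRepresentation T.toRepresentation) ≠ 0 := by
      intro h0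
      rw [hadd, charInner_self_of_mem_Irr hψ, charInner_complexCharacter, h0] at hmχ
      have : 1 = m := by exact_mod_cast hmχ
      rw [← this] at hm
      exact absurd hm (by decide)
    obtain ⟨f, hf⟩ := exists_intertwiningMap_ne_zero hT
    obtain ⟨R, u, -⟩ := exists_equiv_prod_of_injective f
      ((IsIrreducible.injective_or_eq_zero f).resolve_right hf)
    have hdim' := u.toLinearEquiv.finrank_eq
    rw [Module.finrank_prod] at hdim'
    have hR : HasComplexStructure R.toRepresentation := by
      refine ih _ (by omega) R.toRepresentation (fun χ hχ hν => ?_) rfl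
      obtain ⟨i, hi⟩ := exists_natCast_eq_charInner S.toRepresentation hχ
      refine parity (i := i + i) ⟨i, rfl⟩ rfl (exists_natCast_eq_charInner _ hχ) (h χ hχ hν) ?_
      rw [hadd, ← complexCharacter_equiv u, complexCharacter_prod, charInner_add, hi]
      push_cast
      ring
    have hT' : HasComplexStructure (S.toRepresentation.prod T.toRepresentation) := by
      refine (HasComplexStructure.prod_prod S.toRepresentation hR).of_equiv
        (.mk ((LinearEquiv.refl ℝ _).prodCongr u.toLinearEquiv) fun g => ?_)
      refine LinearMap.ext fun v => Prod.ext rfl ?_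
      exact u.toIntertwiningMap.isIntertwining _ _ g v.2
    exact hT'.of_equiv e

end RealCriterion

end GLattice

end


theorem mainTheorem7 {G : Type*} [Group G] [Fintype G]
    {L : Type*} [AddCommGroup L] [Module.Free ℤ L] [Module.Finite ℤ L]
    (ρ : Representation ℤ G L) :
    GLattice.IsEssentiallyComplex ρ ↔
      ∀ V : Subrepresentation (GLattice.extend ℚ ρ),
        V.toRepresentation.IsIrreducible →
        GLattice.IsRealType V.toRepresentation →
        Odd (GLattice.rationalSchurIndex V.toRepresentation) →
        Even (GLattice.simpleMultiplicity ℚ[G] (GLattice.extend ℚ ρ).asModule V.asSubmodule) := by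
  -- Both characters are the integral trace on `L`; this links the rational and real sides.
  have hchar : GLattice.complexCharacter (GLattice.extend ℚ ρ) =
      GLattice.complexCharacter (GLattice.extend ℝ ρ) := by
    ext g
    simp [GLattice.complexCharacter, GLattice.character_extend]
  have hJ : GLattice.IsEssentiallyComplex ρ ↔
      GLattice.HasComplexStructure (GLattice.extend ℝ ρ) := by
    constructor
    · rintro ⟨J, hJ, hsq⟩
      exact ⟨⟨J, hJ⟩, fun v => LinearMap.congr_fun hsq v⟩
    · rintro ⟨J, hJ⟩
      exact ⟨⟨J.toLinearMap, J.isIntertwining', LinearMap.ext hJ⟩⟩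
  rw [GLattice.forall_even_simpleMultiplicity_iff, hchar, hJ]
  exact ⟨fun h χ hχ hν => GLattice.exists_even_charInner_of_hasComplexStructure h hχ hν,
    GLattice.hasComplexStructure_of_forall_even _⟩
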